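/- **Notation.** Let $N\ge 1$ and $k\ge 2$ be integers and $v=(a,b)\in(\mathbb Z/N\mathbb Z)^2$, with representatives $0\le a,b<N$; if $k=2$, assume $v\ne(0,0)$. Put $\mu_N=e^{2\pi i/N}$ and, for $\tau$ in the upper half-plane $\mathbb H$, $$H_k^v(\tau)=\sum_{(m,n)\in\mathbb Z^2\setminus\{(0,0)\}}\frac{\mu_N^{\,mb-na}}{(m\tau+n)^k},\qquad \xi_k^v=\frac{(k-1)!}{(2\pi i)^k}\,H_k^v$$ (for $k=2$ the sum is taken first over $n$, then over $m$). Let $\mathrm{SL}_2(\mathbb Z)$ act on $\mathbb H$ by Möbius transformations, on row vectors $v$ by right multiplication, and on polynomials by $P(X,Y)|_\gamma=P(\alpha X+\beta Y,\gamma' X+\delta Y)$ for $\gamma=\begin{pmatrix}\alpha&\beta\\ \gamma'&\delta\end{pmatrix}$. Let $S=\begin{pmatrix}0&-1\\1&0\end{pmatrix}$ and $T=\begin{pmatrix}1&1\\0&1\end{pmatrix}$. For $f=\xi_k^v$ let $a_0=\lim_{z\to i\infty}f(z)$ be its constant Fourier coefficient, and let $b_0=\lim_{w\to i\infty}(-1/w)^kf(-1/w)$,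 so that $b_0z^{-k}$ is the polar part of $f$ at the cusp $0$. For $0\le p\le k-2$, the regularised integrals with respect to the unit tangent vectors $\vec 1_\infty$ at $i\infty$ and $\vec 1_0$ at $0$ are $$\int_\tau^{\vec 1_\infty}f(z)z^p\,dz=-\frac{a_0\tau^{p+1}}{p+1}+\int_\tau^{i\infty}(f(z)-a_0)z^p\,dz,$$ $$\int_{\vec 1_0}^{\tau}f(z)z^p\,dz=\frac{b_0\tau^{p+1-k}}{p+1-k}+\int_0^{\tau}(f(z)-b_0z^{-k})z^p\,dz,$$ the first being extended coefficientwise to polynomials in $z$ of degree at most $k-2$. The completed $L$-function at an integer $1\le s\le k-1$ is $$\Lambda(f,s)=\int_{\vec 1_0}^{\vec 1_\infty}f(z)z^{s-1}\,dz=\int_{\vec 1_0}^{i}f(z)z^{s-1}\,dz+\int_i^{\vec 1_\infty}f(z)z^{s-1}\,dz .$$ With $\underline f(z)=2\pi i\,f(z)(X-zY)^{k-2}\,dz$, the extended cocycle of $\xi_k^v$ is, for $\gamma\in\mathrm{SL}_2(\mathbb Z)$, $$C_k^v(\gamma)=\Big(\int_{\gamma\tau}^{\vec 1_\infty}\underline{\xi_k^{v\gamma^{-1}}}(z)\Big)\Big|_\gamma-\int_\tau^{\vec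 1_\infty}\underline{\xi_k^v}(z).$$ **Theorem 4.2.** For every base point $\tau\in\mathbb H$, $$C_k^v(T)=(-1)^k\,\frac{2\pi i}{k-1}\,\frac{B_k(a/N)}{k}\,\frac{(X+Y)^{k-1}-X^{k-1}}{Y},$$ $$C_k^v(S)=-2\pi i\sum_{l=0}^{k-2}\binom{k-2}{l}X^{k-2-l}(-Y)^l\,\Lambda(\xi_k^v,l+1),$$ where $B_k$ is the $k$-th Bernoulli polynomial. -/

import Mathlib

open scoped UpperHalfPlane MatrixGroups

noncomputable section

namespace EisensteinCocycle

/-- The symplectic pairing `(u|v) = m * b - n * a` of `u = (m, n)` in `ℤ²` and `v = (a, b)`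
in `(ℤ/N)²`, as an element of `ℤ/N`. -/
def pairing {N : ℕ} (m n : ℤ) (v : Fin 2 → ZMod N) : ZMod N :=
  (m : ZMod N) * v 1 - (n : ZMod N) * v 0

/-- The right action of `SL(2, ℤ)` on row vectors modulo `N`. -/
def rowAct {N : ℕ} (v : Fin 2 → ZMod N) (γ : SL(2, ℤ)) : Fin 2 → ZMod N :=
  Matrix.vecMul v ((γ : Matrix (Fin 2) (Fin 2) ℤ).map (Int.cast : ℤ → ZMod N))

/-- The Eisenstein series
`H_k^v(τ) = ∑' exp(2πi (u|v) / N) / (m τ + n)^k`, the sum running over `u = (m, n) ≠ (0, 0)`.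
It converges absolutely for `k ≥ 3`; the summation order (first `n`, then `m`) only matters for
`k = 2`. Here `ZMod.stdAddChar x = exp(2πi x / N)`. -/
def eisH {N : ℕ} [NeZero N] (k : ℕ) (v : Fin 2 → ZMod N) (τ : ℍ) : ℂ :=
  ∑' m : ℤ, ∑' n : ℤ,
    if m = 0 ∧ n = 0 then 0
    else ZMod.stdAddChar (pairing m n v) / ((m : ℂ) * (τ : ℂ) + (n : ℂ)) ^ k

/-- The normalised series `ξ_k^v = (k-1)! / (2πi)^k * H_k^v`. -/
def xi {N : ℕ} [NeZero N] (k : ℕ) (v : Fin 2 → ZMod N) (τ : ℍ) : ℂ :=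
  ((k - 1).factorial : ℂ) / (2 * (Real.pi : ℂ) * Complex.I) ^ k * eisH k v τ

/-- The constant term `a₀` of the Fourier expansion of `f` at `i∞` (its limit at `i∞`). -/
def constInfty (f : ℍ → ℂ) : ℂ := UpperHalfPlane.valueAtInfty f

/-- The constant `b₀` for which `b₀ z^(-k)` is the polar part of `f` at the cusp `0`: the limit of
`z^k f(z)` for `z = S w = -1/w`, `w → i∞`. -/
def constZero (k : ℕ) (f : ℍ → ℂ) : ℂ :=
  UpperHalfPlane.valueAtInfty
    (fun w : ℍ => ((ModularGroup.S • w : ℍ) : ℂ) ^ k * f (ModularGroup.S • w))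

/-- The regularised integral of `f(z) z^p dz` from `τ` to the unit tangent vector at `i∞`:
`-a₀ τ^(p+1)/(p+1) + ∫_τ^{i∞} (f(z) - a₀) z^p dz`,
the last integral being taken along the vertical ray `z = τ + i t`, `t > 0`. -/
def regIntInfty (f : ℍ → ℂ) (p : ℕ) (τ : ℍ) : ℂ :=
  -(constInfty f * (τ : ℂ) ^ (p + 1) / ((p : ℂ) + 1)) +
    ∫ t in Set.Ioi (0 : ℝ),
      (f (UpperHalfPlane.ofComplex ((τ : ℂ) + (t : ℂ) * Complex.I)) - constInfty f) *
        ((τ : ℂ) + (t : ℂ) * Complex.I) ^ p * Complex.I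

/-- The regularised integral of `f(z) z^p dz` (`0 ≤ p ≤ k - 2`, `f` of weight `k`) from the unit
tangent vector at the cusp `0` to `τ`:
`b₀ τ^(p+1-k)/(p+1-k) + ∫_0^τ (f(z) - b₀ z^(-k)) z^p dz`,
the last integral being taken along the segment `z = t τ`, `0 < t ≤ 1`. The unit tangent vector
at `0` is the image under `S` of the one at `i∞`. -/
def regIntZero (k : ℕ) (f : ℍ → ℂ) (p : ℕ) (τ : ℍ) : ℂ :=
  constZero k f * (τ : ℂ) ^ ((p : ℤ) + 1 - (k : ℤ)) / ((p : ℂ) + 1 - (k : ℂ)) +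
    ∫ t in Set.Ioc (0 : ℝ) 1,
      (f (UpperHalfPlane.ofComplex ((t : ℂ) * (τ : ℂ))) -
          constZero k f * ((t : ℂ) * (τ : ℂ)) ^ (-(k : ℤ))) *
        ((t : ℂ) * (τ : ℂ)) ^ p * (τ : ℂ)

/-- The completed `L`-function `Λ(f, s)` of `f` of weight `k` at an integer `1 ≤ s ≤ k - 1`: the
regularised integral of `f(z) z^(s-1) dz` from the unit tangent vector at `0` to the one at `i∞`,
along the imaginary axis (split at the point `i`). -/
def completedL (k : ℕ) (f : ℍ → ℂ) (s : ℕ) : ℂ :=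
  regIntZero k f (s - 1) UpperHalfPlane.I + regIntInfty f (s - 1) UpperHalfPlane.I

/-- The variable `X`. -/
def polyX : MvPolynomial (Fin 2) ℂ := MvPolynomial.X 0

/-- The variable `Y`. -/
def polyY : MvPolynomial (Fin 2) ℂ := MvPolynomial.X 1

/-- The right action `P(X, Y)|_γ = P(a X + b Y, c X + d Y)` for `γ = (a b; c d)`. -/
def polyAct (P : MvPolynomial (Fin 2) ℂ) (γ : SL(2, ℤ)) : MvPolynomial (Fin 2) ℂ :=
  MvPolynomial.aeval
    (fun i : Fin 2 => MvPolynomial.C ((γ i 0 : ℤ) : ℂ) * polyX +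
      MvPolynomial.C ((γ i 1 : ℤ) : ℂ) * polyY) P

/-- `I_f(τ)`: the regularised integral from `τ` to the unit tangent vector at `i∞` of the
polynomial-valued form `2πi f(z) (X - z Y)^(k-2) dz`, coefficient by coefficient. -/
def formInt (k : ℕ) (f : ℍ → ℂ) (τ : ℍ) : MvPolynomial (Fin 2) ℂ :=
  MvPolynomial.C (2 * (Real.pi : ℂ) * Complex.I) *
    ∑ p ∈ Finset.range (k - 1),
      MvPolynomial.C (((k - 2).choose p : ℂ) * regIntInfty f p τ) *
        polyX ^ (k - 2 - p) * (-polyY) ^ p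

/-- The extended Eisenstein cocycle
`C_k^v(γ) = I_f(γ τ)|_γ - I_g(τ)` with `f = ξ_k^{v γ⁻¹}` and `g = ξ_k^v`,
computed with the base point `τ`. -/
def cocycle {N : ℕ} [NeZero N] (k : ℕ) (v : Fin 2 → ZMod N) (γ : SL(2, ℤ)) (τ : ℍ) :
    MvPolynomial (Fin 2) ℂ :=
  polyAct (formInt k (xi k (rowAct v γ⁻¹)) (γ • τ)) γ - formInt k (xi k v) τ

end EisensteinCocycle

end

open scoped UpperHalfPlane MatrixGroups

noncomputable section

namespace EisensteinCocycle

/-! ### Lipschitz formula and exponential decay of twisted row sums -/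

section

/-! Three facts about `ξ_k^v` carry the theorem: it approaches its constant term exponentially fast
at `i∞`; it satisfies the weight `k` law relating `v` to `vT⁻¹` and `vS⁻¹`; and the Fourier series
of the Bernoulli polynomials gives `a₀ = -(-1)^k B_k(a/N)/k` (`xiConst_eq`).

For `T`, the form `ξ(z)(X - zY)^(k-2) dz` is carried to itself by `z ↦ z + 1`, `X ↦ X + Y`. The
convergent integrals cancel, and only the primitives of the constant term remain. They differ by a
multiple of `(X+Y)^(k-1) - X^(k-1)` (`mul_xiForm_T`).

For `S`, both integrals in the cocycle have the same derivative in the base point, so their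
difference is constant on the upper half-plane (`xiForm_S_sub_eq`) and may be computed at the fixed
point `i`. There `z ↦ -1/z` turns the integral from `i` to `i∞` of the series for `vS⁻¹` into the
integral from `0` to `i` of the series for `v`, up to sign (`regIntZero_xi_I`). Together with the
integral from `i` to `i∞` this is `Λ`.

The delicate point is the law under `S` in weight 2, where the double series is not absolutely
convergent and the order of summation must be exchanged. Comparing the series with a shift of itself
by a vector on which the character is nontrivial gains one power of decay
(`tsum_comm_of_summable_shift_sub`); such a vector exists because `v ≠ 0`. -/

theorem norm_exp_two_pi_I_mul (z : ℂ) :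
    ‖Complex.exp (2 * (Real.pi : ℂ) * Complex.I * z)‖ = Real.exp (-(2 * Real.pi * z.im)) := by
  rw [Complex.norm_exp]
  simp

theorem tsum_inv_pow_eq {k : ℕ} (hk : 2 ≤ k) {z : ℂ} (hz : 0 < z.im) :
    ∑' n : ℤ, 1 / (z + n) ^ k = ((-2 * (Real.pi : ℂ) * Complex.I) ^ k / ((k - 1).factorial : ℂ)) *
      ∑' n : ℕ, (n : ℂ) ^ (k - 1) * Complex.exp (2 * (Real.pi : ℂ) * Complex.I * z) ^ n := by
  have h := EisensteinSeries.qExpansion_identity (k := k - 1) (by omega) ⟨z, hz⟩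
  rwa [Nat.sub_add_cancel (by omega)] at h

/-- With `q = exp(2πiz)`, one factor of `|q|^n` is kept and the other `n - 1` are bounded by
`exp(-2πδ)`. The majorant is thus summable in `n` and still decays in `Im z`. The term `n = 0`
vanishes because `k ≥ 2`. -/
theorem norm_pow_mul_exp_le {k : ℕ} (hk : 2 ≤ k) {δ : ℝ} {z : ℂ} (hz : δ ≤ z.im) (n : ℕ) :
    ‖(n : ℂ) ^ (k - 1) * Complex.exp (2 * (Real.pi : ℂ) * Complex.I * z) ^ n‖ ≤
      (n : ℝ) ^ (k - 1) * Real.exp (-(2 * Real.pi * δ)) ^ n *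
        (Real.exp (2 * Real.pi * δ) * Real.exp (-(2 * Real.pi * z.im))) := by
  rw [norm_mul, norm_pow, norm_pow, norm_exp_two_pi_I_mul, Complex.norm_natCast]
  rcases n with _ | n
  · simp [show k - 1 ≠ 0 by omega]
  · have h : Real.exp (-(2 * Real.pi * δ)) * Real.exp (2 * Real.pi * δ) = 1 := by
      rw [← Real.exp_add, neg_add_cancel, Real.exp_zero]
    rw [mul_assoc (_ ^ (k - 1))]
    refine mul_le_mul_of_nonneg_left ?_ (pow_nonneg (Nat.cast_nonneg _) _)
    rw [pow_succ, pow_succ, mul_assoc (Real.exp (-(2 * Real.pi * δ)) ^ n),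
      ← mul_assoc (Real.exp (-(2 * Real.pi * δ))),
      h, one_mul]
    exact mul_le_mul_of_nonneg_right (pow_le_pow_left₀ (Real.exp_nonneg _)
      (Real.exp_le_exp.2 (by gcongr)) _) (Real.exp_nonneg _)

theorem summable_pow_mul_exp (k : ℕ) {δ : ℝ} (hδ : 0 < δ) :
    Summable fun n : ℕ => (n : ℝ) ^ k * Real.exp (-(2 * Real.pi * δ)) ^ n := by
  apply summable_pow_mul_geometric_of_norm_lt_one
  rw [Real.norm_eq_abs, Real.abs_exp, Real.exp_lt_one_iff]
  have := Real.pi_pos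
  simp only [Left.neg_neg_iff]
  positivity

theorem exists_norm_tsum_inv_pow_le {k : ℕ} (hk : 2 ≤ k) {δ : ℝ} (hδ : 0 < δ) :
    ∃ C : ℝ, 0 ≤ C ∧ ∀ z : ℂ, δ ≤ z.im →
      ‖∑' n : ℤ, 1 / (z + n) ^ k‖ ≤ C * Real.exp (-(2 * Real.pi * z.im)) := by
  refine ⟨‖(-2 * (Real.pi : ℂ) * Complex.I) ^ k / ((k - 1).factorial : ℂ)‖ *
    ((∑' n : ℕ, (n : ℝ) ^ (k - 1) * Real.exp (-(2 * Real.pi * δ)) ^ n) *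
      Real.exp (2 * Real.pi * δ)), ?_, fun z hz => ?_⟩
  · have : 0 ≤ ∑' n : ℕ, (n : ℝ) ^ (k - 1) * Real.exp (-(2 * Real.pi * δ)) ^ n :=
      tsum_nonneg fun n => by positivity
    positivity
  · rw [tsum_inv_pow_eq hk (hδ.trans_le hz), norm_mul, mul_assoc ‖_‖, mul_assoc (∑' _, _)]
    refine mul_le_mul_of_nonneg_left ?_ (norm_nonneg _)
    exact tsum_of_norm_bounded ((summable_pow_mul_exp (k - 1) hδ).hasSum.mul_right _)
      (norm_pow_mul_exp_le hk hz)

theorem isOpen_im_gt (δ : ℝ) : IsOpen {z : ℂ | δ < z.im} :=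
  isOpen_lt continuous_const Complex.continuous_im

theorem differentiableOn_of_forall_im_gt {F : ℂ → ℂ}
    (h : ∀ δ : ℝ, 0 < δ → DifferentiableOn ℂ F {z | δ < z.im}) :
    DifferentiableOn ℂ F {z | 0 < z.im} := by
  intro z hz
  have hz' : z.im / 2 < z.im := half_lt_self hz
  exact ((h (z.im / 2) (half_pos hz)).differentiableAt
    ((isOpen_im_gt _).mem_nhds hz')).differentiableWithinAt

theorem differentiableOn_tsum_inv_pow {k : ℕ} (hk : 2 ≤ k) :
    DifferentiableOn ℂ (fun z : ℂ => ∑' n : ℤ, 1 / (z + n) ^ k) {z | 0 < z.im} := by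
  refine DifferentiableOn.congr (f := fun z : ℂ =>
    ((-2 * (Real.pi : ℂ) * Complex.I) ^ k / ((k - 1).factorial : ℂ)) *
      ∑' n : ℕ, (n : ℂ) ^ (k - 1) * Complex.exp (2 * (Real.pi : ℂ) * Complex.I * z) ^ n) ?_
    fun z hz => tsum_inv_pow_eq hk hz
  refine DifferentiableOn.const_mul ?_ _
  refine differentiableOn_of_forall_im_gt fun δ hδ => ?_
  refine Complex.differentiableOn_tsum_of_summable_norm (summable_pow_mul_exp (k - 1) hδ)
    (fun n => by fun_prop) (isOpen_im_gt δ) fun n z hz => ?_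
  refine (norm_pow_mul_exp_le hk (le_of_lt hz) n).trans (mul_le_of_le_one_right (by positivity) ?_)
  rw [← Real.exp_add, Real.exp_le_one_iff]
  have : δ < z.im := hz
  nlinarith [Real.pi_pos]

theorem summable_inv_add_int_pow {k : ℕ} (hk : 2 ≤ k) (z : ℂ) :
    Summable fun n : ℤ => 1 / (z + n) ^ k := by
  have := EisensteinSeries.linear_right_summable z 1 (k := k) (by exact_mod_cast hk)
  simpa using this

/-- The row sum `∑ ψ(n) / (z + n)^k` for a function `ψ` on `ℤ/N`. -/
def periodicSum {N : ℕ} (k : ℕ) (ψ : ZMod N → ℂ) (z : ℂ) : ℂ :=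
  ∑' n : ℤ, ψ n / (z + n) ^ k

variable {N : ℕ}

theorem im_add_natCast_div (z : ℂ) (r : ℕ) : ((z + r) / N).im = z.im / N := by
  simp [Complex.div_natCast_im]

theorem periodicSum_neg (k : ℕ) (ψ : ZMod N → ℂ) (z : ℂ) :
    periodicSum k ψ (-z) = (-1) ^ k * periodicSum k (fun x => ψ (-x)) z := by
  rw [periodicSum, periodicSum, ← (Equiv.neg ℤ).tsum_eq, ← tsum_mul_left]
  refine tsum_congr fun n => ?_
  rw [Equiv.neg_apply, show -z + ((-n : ℤ) : ℂ) = (-1) * (z + n) by push_cast; ring, mul_pow,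
    Int.cast_neg, div_mul_eq_div_div, div_eq_mul_inv (ψ _), ← inv_pow, inv_neg_one]
  ring

variable [NeZero N]

theorem summable_periodicSum {k : ℕ} (hk : 2 ≤ k) (ψ : ZMod N → ℂ) (z : ℂ) :
    Summable fun n : ℤ => ψ n / (z + n) ^ k := by
  obtain ⟨M, hM⟩ := (Set.finite_range fun x => ‖ψ x‖).bddAbove
  refine Summable.of_norm_bounded ((summable_inv_add_int_pow hk z).norm.mul_left M) fun n => ?_
  rw [div_eq_mul_one_div, norm_mul]
  gcongr
  exact hM ⟨_, rfl⟩

/-- Writing `n = jN + r` makes `ψ` constant on each residue class, which leaves a Lipschitz sum at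
`(z + r)/N`. The division by `N` is the source of the decay rate `2π/N`. -/
theorem periodicSum_eq_sum {k : ℕ} (hk : 2 ≤ k) (ψ : ZMod N → ℂ) (z : ℂ) :
    periodicSum k ψ z = ∑ r : Fin N, ψ (r : ℕ) * ((1 / (N : ℂ) ^ k) *
      ∑' j : ℤ, 1 / ((z + (r : ℕ)) / N + j) ^ k) := by
  have hN : (N : ℂ) ≠ 0 := NeZero.ne _
  obtain ⟨e, he⟩ : ∃ e : Fin N × ℤ ≃ ℤ, ∀ r j, e (r, j) = j * N + (r : ℕ) :=
    ⟨(Equiv.prodComm _ _).trans (Int.divModEquiv N).symm, fun r j => rfl⟩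
  have hs := (e.summable_iff).2 (summable_periodicSum hk ψ z)
  rw [periodicSum, ← e.tsum_eq]
  refine (Summable.tsum_prod hs).trans ?_
  rw [tsum_fintype]
  refine Finset.sum_congr rfl fun r _ => ?_
  rw [← tsum_mul_left, ← tsum_mul_left]
  refine tsum_congr fun j => ?_
  rw [Function.comp_apply, he, show z + ((j * N + (r : ℕ) : ℤ) : ℂ) = N * ((z + (r : ℕ)) / N + j) by
    push_cast; field_simp; ring, mul_pow]
  push_cast
  rw [ZMod.natCast_self, mul_zero, zero_add, div_eq_mul_one_div, one_div_mul_one_div]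

/-- The constant must not depend on `ψ`, since the coefficients of the `m`-th row of `H_k^v` vary
with `m`. -/
theorem exists_norm_periodicSum_le {k : ℕ} (hk : 2 ≤ k) {δ : ℝ} (hδ : 0 < δ) :
    ∃ C : ℝ, 0 ≤ C ∧ ∀ ψ : ZMod N → ℂ, (∀ x, ‖ψ x‖ ≤ 1) → ∀ z : ℂ, δ ≤ z.im →
      ‖periodicSum k ψ z‖ ≤ C * Real.exp (-(2 * Real.pi / N * z.im)) := by
  have hN : (0 : ℝ) < N := Nat.cast_pos.2 (NeZero.pos N)
  obtain ⟨C, hC, h⟩ := exists_norm_tsum_inv_pow_le hk (div_pos hδ hN)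
  refine ⟨∑ r : Fin N, 1 * (‖1 / (N : ℂ) ^ k‖ * C), by positivity, fun ψ hψ z hz => ?_⟩
  rw [periodicSum_eq_sum hk, Finset.sum_mul]
  refine norm_sum_le_of_le _ fun r _ => ?_
  rw [norm_mul, norm_mul, mul_assoc, mul_assoc]
  gcongr
  · exact hψ _
  · have := h ((z + (r : ℕ)) / N) (by rw [im_add_natCast_div]; gcongr)
    rwa [im_add_natCast_div, mul_div_assoc', ← div_mul_eq_mul_div] at this

theorem differentiableOn_periodicSum {k : ℕ} (hk : 2 ≤ k) (ψ : ZMod N → ℂ) :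
    DifferentiableOn ℂ (periodicSum k ψ) {z | 0 < z.im} := by
  have hN : (0 : ℝ) < N := Nat.cast_pos.2 (NeZero.pos N)
  refine DifferentiableOn.congr (DifferentiableOn.fun_sum (u := Finset.univ) fun r _ => ?_)
    fun z _ => periodicSum_eq_sum hk ψ z
  refine DifferentiableOn.const_mul (DifferentiableOn.const_mul ?_ _) _
  refine (differentiableOn_tsum_inv_pow hk).comp (g := fun w : ℂ => ∑' j : ℤ, 1 / (w + j) ^ k)
    (f := fun z : ℂ => (z + (r : ℕ)) / N) (by fun_prop) fun z hz => ?_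
  have hz' : 0 < z.im := hz
  simp only [Set.mem_ofPred_eq, im_add_natCast_div]
  positivity

end

/-! ### Convergence, holomorphy and constant term of the Eisenstein series -/

section

variable {N : ℕ} [NeZero N]

/-- The coefficients `n ↦ exp(2πi (m b - n a) / N)` of the `m`-th row of `H_k^v`. -/
def rowChar (v : Fin 2 → ZMod N) (m : ℤ) (x : ZMod N) : ℂ :=
  ZMod.stdAddChar ((m : ZMod N) * v 1 - x * v 0)

theorem norm_stdAddChar (x : ZMod N) : ‖(ZMod.stdAddChar x : ℂ)‖ = 1 := by
  rw [ZMod.stdAddChar_apply, Circle.norm_coe]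

theorem norm_rowChar_le (v : Fin 2 → ZMod N) (m : ℤ) (x : ZMod N) : ‖rowChar v m x‖ ≤ 1 :=
  (norm_stdAddChar _).le

/-- The series `H_k^v` as a function on `ℂ`, summed row by row. -/
def eisSeries (k : ℕ) (v : Fin 2 → ZMod N) (z : ℂ) : ℂ :=
  ∑' m : ℤ, periodicSum k (rowChar v m) (m * z)

theorem eisH_eq_eisSeries {k : ℕ} (hk : 2 ≤ k) (v : Fin 2 → ZMod N) (τ : ℍ) :
    eisH k v τ = eisSeries k v τ := by
  refine tsum_congr fun m => tsum_congr fun n => ?_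
  split_ifs with h
  -- The excluded term at the origin has denominator `0 ^ k = 0`, so it is zero by the convention
  -- for division and may be included in the row sum.
  · simp [h.1, h.2, show k ≠ 0 by omega]
  · rfl

theorem exists_norm_row_le {k : ℕ} (hk : 2 ≤ k) (v : Fin 2 → ZMod N) {δ : ℝ} (hδ : 0 < δ) :
    ∃ C : ℝ, 0 ≤ C ∧ ∀ m : ℤ, m ≠ 0 → ∀ z : ℂ, δ ≤ z.im →
      ‖periodicSum k (rowChar v m) (m * z)‖ ≤ C * Real.exp (-(2 * Real.pi / N * (|(m : ℝ)| * z.im))) := by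
  obtain ⟨C, hC, h⟩ := exists_norm_periodicSum_le (N := N) hk hδ
  refine ⟨C, hC, fun m hm z hz => ?_⟩
  have key : ∀ m : ℤ, 0 < m → δ ≤ ((m : ℂ) * z).im ∧ ((m : ℂ) * z).im = |(m : ℝ)| * z.im := by
    intro m hm
    have h1 : (1 : ℝ) ≤ m := by exact_mod_cast hm
    have h2 : ((m : ℂ) * z).im = |(m : ℝ)| * z.im := by
      rw [abs_of_pos (by linarith)]; simp
    refine ⟨?_, h2⟩
    rw [h2, abs_of_pos (by linarith)]
    nlinarith
  rcases lt_or_gt_of_ne hm with hm | hm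
  -- For `m < 0` the reflection `n ↦ -n` gives a row whose argument `-m z` lies in the upper
  -- half-plane.
  · obtain ⟨h1, h2⟩ := key (-m) (by omega)
    have h3 := h (fun x => rowChar v m (-x)) (fun x => norm_rowChar_le v m _) _ h1
    rw [h2] at h3
    rw [show (m : ℂ) * z = -(((-m : ℤ) : ℂ) * z) by push_cast; ring, periodicSum_neg, norm_mul,
      norm_pow, norm_neg, norm_one, one_pow, one_mul]
    simpa using h3
  · obtain ⟨h1, h2⟩ := key m hm
    have h3 := h (rowChar v m) (norm_rowChar_le v m) _ h1
    rwa [h2] at h3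

theorem summable_exp_neg_mul_abs_int {c : ℝ} (hc : 0 < c) :
    Summable fun m : ℤ => Real.exp (-(c * |(m : ℝ)|)) := by
  have h : Summable fun n : ℕ => Real.exp (-(c * (n : ℝ))) := by
    simpa [mul_comm] using Real.summable_exp_nat_mul_iff.2 (neg_lt_zero.2 hc)
  refine Summable.of_nat_of_neg ?_ ?_ <;> simpa using h

theorem two_pi_div_pos (N : ℕ) [NeZero N] : 0 < 2 * Real.pi / N := by
  have : (0 : ℝ) < N := Nat.cast_pos.2 (NeZero.pos N)
  have := Real.pi_pos
  positivity

/-- The inequality `(|m| - 1)(Im z - δ) ≥ 0` bounds `|m| Im z` below by `δ|m| + Im z - δ`, which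
separates summability in `m` from decay in `z`. -/
theorem exists_summable_row_bound {k : ℕ} (hk : 2 ≤ k) (v : Fin 2 → ZMod N) {δ : ℝ} (hδ : 0 < δ) :
    ∃ u : ℤ → ℝ, (∀ m, 0 ≤ u m) ∧ Summable u ∧ ∀ m : ℤ, m ≠ 0 → ∀ z : ℂ, δ ≤ z.im →
      ‖periodicSum k (rowChar v m) (m * z)‖ ≤ u m * Real.exp (-(2 * Real.pi / N * z.im)) := by
  obtain ⟨C, hC, h⟩ := exists_norm_row_le hk v hδ
  have hc := two_pi_div_pos N
  set c : ℝ := 2 * Real.pi / N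
  refine ⟨fun m => C * Real.exp (c * δ) * Real.exp (-(c * δ * |(m : ℝ)|)), fun m => by positivity,
    (summable_exp_neg_mul_abs_int (by positivity)).mul_left _, fun m hm z hz =>
    (h m hm z hz).trans ?_⟩
  rw [mul_assoc, mul_assoc]
  refine mul_le_mul_of_nonneg_left ?_ hC
  rw [← Real.exp_add, ← Real.exp_add, Real.exp_le_exp]
  have h1 : (1 : ℝ) ≤ |(m : ℝ)| := by exact_mod_cast Int.one_le_abs hm
  nlinarith [mul_nonneg hc.le (mul_nonneg (sub_nonneg.2 h1) (sub_nonneg.2 hz))]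

theorem summable_rows {k : ℕ} (hk : 2 ≤ k) (v : Fin 2 → ZMod N) {z : ℂ} (hz : 0 < z.im) :
    Summable fun m : ℤ => periodicSum k (rowChar v m) (m * z) := by
  obtain ⟨u, -, hu, h⟩ := exists_summable_row_bound hk v hz
  refine Summable.of_norm_bounded_eventually (hu.mul_right (Real.exp (-(2 * Real.pi / N * z.im)))) ?_
  filter_upwards [(Set.finite_singleton (0 : ℤ)).compl_mem_cofinite] with m hm
  exact h m hm z le_rfl

/-- The row `m = 0` of `H_k^v`. -/
def eisConst (k : ℕ) (v : Fin 2 → ZMod N) : ℂ := periodicSum k (rowChar v 0) 0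

theorem eisSeries_eq_add {k : ℕ} (hk : 2 ≤ k) (v : Fin 2 → ZMod N) {z : ℂ} (hz : 0 < z.im) :
    eisSeries k v z = eisConst k v +
      ∑' m : ℤ, if m = 0 then 0 else periodicSum k (rowChar v m) (m * z) := by
  rw [eisSeries, (summable_rows hk v hz).tsum_eq_add_tsum_ite 0, eisConst]
  simp

theorem exists_norm_eisSeries_sub_le {k : ℕ} (hk : 2 ≤ k) (v : Fin 2 → ZMod N) {δ : ℝ}
    (hδ : 0 < δ) : ∃ C : ℝ, 0 ≤ C ∧ ∀ z : ℂ, δ ≤ z.im →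
      ‖eisSeries k v z - eisConst k v‖ ≤ C * Real.exp (-(2 * Real.pi / N * z.im)) := by
  obtain ⟨u, hu0, hu, h⟩ := exists_summable_row_bound hk v hδ
  refine ⟨∑' m, u m, tsum_nonneg hu0, fun z hz => ?_⟩
  rw [eisSeries_eq_add hk v (hδ.trans_le hz), add_sub_cancel_left]
  refine tsum_of_norm_bounded (hu.hasSum.mul_right _) fun m => ?_
  split_ifs with hm
  · simpa using mul_nonneg (hu0 m) (Real.exp_nonneg _)
  · exact h m hm z hz

theorem differentiableOn_row {k : ℕ} (hk : 2 ≤ k) (v : Fin 2 → ZMod N) {m : ℤ} (hm : m ≠ 0) :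
    DifferentiableOn ℂ (fun z : ℂ => periodicSum k (rowChar v m) (m * z)) {z | 0 < z.im} := by
  rcases lt_or_gt_of_ne hm with hm | hm
  · have h : ∀ z : ℂ, periodicSum k (rowChar v m) (m * z) =
        (-1) ^ k * periodicSum k (fun x => rowChar v m (-x)) (((-m : ℤ) : ℂ) * z) := fun z => by
      rw [← periodicSum_neg]; push_cast; rw [neg_mul, neg_neg]
    simp_rw [h]
    refine DifferentiableOn.const_mul ((differentiableOn_periodicSum hk _).comp
      (f := fun z : ℂ => ((-m : ℤ) : ℂ) * z) (by fun_prop) fun z hz => ?_) _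
    have h1 : (0 : ℝ) < (-m : ℤ) := by exact_mod_cast neg_pos.2 hm
    have h2 : 0 < z.im := hz
    have h3 : (((-m : ℤ) : ℂ) * z).im = ((-m : ℤ) : ℝ) * z.im := by
      rw [← Complex.ofReal_intCast, Complex.im_ofReal_mul]
    rw [Set.mem_ofPred_eq, h3]
    positivity
  · refine (differentiableOn_periodicSum hk _).comp
      (f := fun z : ℂ => (m : ℂ) * z) (by fun_prop) fun z hz => ?_
    have h1 : (0 : ℝ) < m := by exact_mod_cast hm
    have h2 : 0 < z.im := hz
    have h3 : ((m : ℂ) * z).im = (m : ℝ) * z.im := by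
      rw [← Complex.ofReal_intCast, Complex.im_ofReal_mul]
    rw [Set.mem_ofPred_eq, h3]
    positivity

theorem differentiableOn_eisSeries {k : ℕ} (hk : 2 ≤ k) (v : Fin 2 → ZMod N) :
    DifferentiableOn ℂ (eisSeries k v) {z | 0 < z.im} := by
  suffices hdiff : DifferentiableOn ℂ (fun z : ℂ => ∑' m : ℤ,
      if m = 0 then 0 else periodicSum k (rowChar v m) (m * z)) {z | 0 < z.im} by
    exact (hdiff.const_add (eisConst k v)).congr fun z hz => eisSeries_eq_add hk v hz
  refine differentiableOn_of_forall_im_gt fun δ hδ => ?_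
  obtain ⟨u, hu0, hu, h⟩ := exists_summable_row_bound hk v hδ
  refine Complex.differentiableOn_tsum_of_summable_norm hu (fun m => ?_) (isOpen_im_gt δ)
    fun m z hz => ?_
  · split_ifs with hm
    · exact differentiableOn_const _
    · exact (differentiableOn_row hk v hm).mono fun z hz => hδ.trans hz
  · have hz' : δ < z.im := hz
    split_ifs with hm
    · simpa using hu0 m
    · refine (h m hm z hz'.le).trans (mul_le_of_le_one_right (hu0 m) ?_)
      rw [Real.exp_le_one_iff, neg_nonpos]
      exact mul_nonneg (two_pi_div_pos N).le (hδ.trans hz').le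

end

/-! ### Integrals along vertical rays as primitives -/

section

/-- Exponential decay towards `i∞` in vertical strips of the upper half plane. -/
def StripDecay (h : ℂ → ℂ) : Prop :=
  ∀ δ : ℝ, 0 < δ → ∀ M : ℝ, ∃ C c : ℝ, 0 ≤ C ∧ 0 < c ∧
    ∀ z : ℂ, δ ≤ z.im → |z.re| ≤ M → ‖h z‖ ≤ C * Real.exp (-c * z.im)

theorem im_add_ofReal_mul_I (z : ℂ) (t : ℝ) : (z + t * Complex.I).im = z.im + t := by simp

theorem re_add_ofReal_mul_I (z : ℂ) (t : ℝ) : (z + t * Complex.I).re = z.re := by simp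

theorem continuousOn_comp_ray {h : ℂ → ℂ} (hh : ContinuousOn h {z | 0 < z.im}) {z : ℂ}
    (hz : 0 < z.im) : ContinuousOn (fun t : ℝ => h (z + t * Complex.I)) (Set.Ici 0) := by
  refine hh.comp (by fun_prop) fun t ht => ?_
  have ht' : 0 ≤ t := ht
  rw [Set.mem_ofPred_eq, im_add_ofReal_mul_I]
  linarith

theorem StripDecay.norm_ray_le {h : ℂ → ℂ} (hd : StripDecay h) {z : ℂ} (hz : 0 < z.im) :
    ∃ C c : ℝ, 0 ≤ C ∧ 0 < c ∧ ∀ t : ℝ, 0 ≤ t → ‖h (z + t * Complex.I)‖ ≤ C * Real.exp (-c * t) := by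
  obtain ⟨C, c, hC, hc, H⟩ := hd z.im hz |z.re|
  refine ⟨C, c, hC, hc, fun t ht => (H _ ?_ ?_).trans ?_⟩
  · rw [im_add_ofReal_mul_I]; linarith
  · rw [re_add_ofReal_mul_I]
  · rw [im_add_ofReal_mul_I]
    refine mul_le_mul_of_nonneg_left (Real.exp_le_exp.2 ?_) hC
    nlinarith

theorem integrableOn_ray {h : ℂ → ℂ} (hh : ContinuousOn h {z | 0 < z.im}) (hd : StripDecay h)
    {z : ℂ} (hz : 0 < z.im) :
    MeasureTheory.IntegrableOn (fun t : ℝ => h (z + t * Complex.I)) (Set.Ioi 0) := by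
  obtain ⟨C, c, hC, hc, H⟩ := hd.norm_ray_le hz
  refine MeasureTheory.Integrable.mono' ((exp_neg_integrableOn_Ioi 0 hc).const_mul C)
    (((continuousOn_comp_ray hh hz).mono Set.Ioi_subset_Ici_self).aestronglyMeasurable
      measurableSet_Ioi) ?_
  filter_upwards [MeasureTheory.ae_restrict_mem measurableSet_Ioi] with t ht
  exact H t (le_of_lt ht)

theorem tendsto_ray {h : ℂ → ℂ} (hd : StripDecay h) {z : ℂ} (hz : 0 < z.im) :
    Filter.Tendsto (fun t : ℝ => h (z + t * Complex.I)) Filter.atTop (nhds 0) := by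
  obtain ⟨C, c, hC, hc, H⟩ := hd.norm_ray_le hz
  have h1 : Filter.Tendsto (fun t : ℝ => C * Real.exp (-c * t)) Filter.atTop (nhds (C * 0)) :=
    (Real.tendsto_exp_atBot.comp
      (Filter.tendsto_id.const_mul_atTop_of_neg (neg_lt_zero.2 hc))).const_mul C
  rw [mul_zero] at h1
  refine squeeze_zero_norm' ?_ h1
  filter_upwards [Filter.eventually_ge_atTop 0] with t ht using H t ht

/-- Cauchy's estimate on circles of radius `δ/2`: these stay above height `δ/2` and in a strip wider
by `δ/2`, at the cost of a factor `exp(cδ/2)/(δ/2)`. -/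
theorem StripDecay.deriv {h : ℂ → ℂ} (hh : DifferentiableOn ℂ h {z | 0 < z.im})
    (hd : StripDecay h) : StripDecay (deriv h) := by
  intro δ hδ M
  obtain ⟨C, c, hC, hc, H⟩ := hd (δ / 2) (half_pos hδ) (M + δ / 2)
  refine ⟨C * Real.exp (c * (δ / 2)) / (δ / 2), c, by positivity, hc, fun z hz hM => ?_⟩
  have hball : ∀ w ∈ Metric.closedBall z (δ / 2), z.im - δ / 2 ≤ w.im ∧ |w.re| ≤ M + δ / 2 := by
    intro w hw
    rw [Metric.mem_closedBall, dist_eq_norm] at hw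
    have h1 := (Complex.abs_im_le_norm (w - z)).trans hw
    have h2 := (Complex.abs_re_le_norm (w - z)).trans hw
    rw [Complex.sub_im, abs_le] at h1
    rw [Complex.sub_re] at h2
    refine ⟨by linarith, ?_⟩
    have h3 := abs_add_le (w.re - z.re) z.re
    rw [sub_add_cancel] at h3
    linarith
  have key := Complex.norm_deriv_le_of_forall_mem_sphere_norm_le (c := z) (half_pos hδ)
    (f := h) (C := C * Real.exp (c * (δ / 2)) * Real.exp (-c * z.im)) ?_ ?_
  · refine key.trans (le_of_eq ?_)
    ring
  · refine DifferentiableOn.diffContOnCl (hh.mono fun w hw => ?_)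
    rw [closure_ball _ (half_pos hδ).ne'] at hw
    have := (hball w hw).1
    rw [Set.mem_ofPred_eq]
    linarith
  · intro w hw
    obtain ⟨h1, h2⟩ := hball w (Metric.sphere_subset_closedBall hw)
    refine (H w (by linarith) h2).trans ?_
    rw [mul_assoc, ← Real.exp_add]
    gcongr
    nlinarith

/-- Differentiation under the integral, dominated through the decay of `h'` on a disc of radius `Im
z / 2`, followed by the fundamental theorem of calculus along the ray. This takes the place of
contour deformation: dependence on the base point is controlled by derivatives alone. -/
theorem hasDerivAt_integral_ray {h : ℂ → ℂ} (hh : DifferentiableOn ℂ h {z | 0 < z.im})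
    (hd : StripDecay h) {z : ℂ} (hz : 0 < z.im) :
    HasDerivAt (fun w : ℂ => ∫ t in Set.Ioi (0 : ℝ), h (w + t * Complex.I) * Complex.I)
      (-h z) z := by
  have hopen := isOpen_im_gt 0
  have hd' := hd.deriv hh
  have hh' : ContinuousOn (deriv h) {z | 0 < z.im} := (hh.deriv hopen).continuousOn
  have hat : ∀ w : ℂ, 0 < w.im → HasDerivAt h (deriv h w) w := fun w hw =>
    (hh.differentiableAt (hopen.mem_nhds hw)).hasDerivAt
  have hball : ∀ w ∈ Metric.ball z (z.im / 2), z.im / 2 ≤ w.im ∧ |w.re| ≤ |z.re| + z.im / 2 := by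
    intro w hw
    rw [Metric.mem_ball, dist_eq_norm] at hw
    have h1 := (Complex.abs_im_le_norm (w - z)).trans hw.le
    have h2 := (Complex.abs_re_le_norm (w - z)).trans hw.le
    rw [Complex.sub_im, abs_le] at h1
    rw [Complex.sub_re] at h2
    refine ⟨by linarith, ?_⟩
    have h3 := abs_add_le (w.re - z.re) z.re
    rw [sub_add_cancel] at h3
    linarith
  have hFTC : ∫ t in Set.Ioi (0 : ℝ), deriv h (z + t * Complex.I) * Complex.I = -h z := by
    have := MeasureTheory.integral_Ioi_of_hasDerivAt_of_tendsto' (a := 0)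
      (f := fun t : ℝ => h (z + t * Complex.I))
      (f' := fun t : ℝ => deriv h (z + t * Complex.I) * Complex.I) (m := 0) ?_ ?_ (tendsto_ray hd hz)
    · simpa using this
    · intro t ht
      have ht' : 0 ≤ t := ht
      have h1 : HasDerivAt (fun s : ℂ => z + s * Complex.I) Complex.I (t : ℂ) := by
        simpa using ((hasDerivAt_id (t : ℂ)).mul_const Complex.I).const_add z
      exact ((hat (z + t * Complex.I) (by rw [im_add_ofReal_mul_I]; linarith)).comp (t : ℂ)
        h1).comp_ofReal
    · exact (integrableOn_ray hh' hd' hz).mul_const _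
  obtain ⟨C, c, hC, hc, H⟩ := hd' (z.im / 2) (half_pos hz) (|z.re| + z.im / 2)
  rw [← hFTC]
  refine (hasDerivAt_integral_of_dominated_loc_of_deriv_le (𝕜 := ℂ)
    (F := fun (w : ℂ) (t : ℝ) => h (w + t * Complex.I) * Complex.I)
    (F' := fun (w : ℂ) (t : ℝ) => deriv h (w + t * Complex.I) * Complex.I)
    (bound := fun t => C * Real.exp (-c * t))
    (Metric.ball_mem_nhds z (half_pos hz)) ?_ ((integrableOn_ray hh.continuousOn hd hz).mul_const _)
    ((integrableOn_ray hh' hd' hz).mul_const _).aestronglyMeasurable ?_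
    ((exp_neg_integrableOn_Ioi 0 hc).const_mul C) ?_).2
  · filter_upwards [hopen.mem_nhds hz] with w hw
    exact ((integrableOn_ray hh.continuousOn hd hw).mul_const _).aestronglyMeasurable
  · filter_upwards [MeasureTheory.ae_restrict_mem measurableSet_Ioi] with t ht w hw
    have ht' : 0 < t := ht
    obtain ⟨h1, h2⟩ := hball w hw
    rw [norm_mul, Complex.norm_I, mul_one]
    refine (H _ ?_ ?_).trans ?_
    · rw [im_add_ofReal_mul_I]; linarith
    · rwa [re_add_ofReal_mul_I]
    · rw [im_add_ofReal_mul_I]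
      refine mul_le_mul_of_nonneg_left (Real.exp_le_exp.2 ?_) hC
      nlinarith
  · filter_upwards [MeasureTheory.ae_restrict_mem measurableSet_Ioi] with t ht w hw
    have ht' : 0 < t := ht
    obtain ⟨h1, h2⟩ := hball w hw
    refine HasDerivAt.mul_const ?_ _
    exact (hat (w + t * Complex.I) (by rw [im_add_ofReal_mul_I]; linarith)).comp_add_const w _

theorem exists_add_pow_mul_exp_le (M : ℝ) (hM : 0 ≤ M) (p : ℕ) {c : ℝ} (hc : 0 < c) :
    ∃ C : ℝ, 0 ≤ C ∧ ∀ y : ℝ, 0 ≤ y → (M + y) ^ p * Real.exp (-c * y) ≤ C := by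
  -- The constant comes from `x^p / p! ≤ exp x` at `x = c(M + y)`.
  refine ⟨p.factorial / c ^ p * Real.exp (c * M), by positivity, fun y hy => ?_⟩
  have h := Real.pow_div_factorial_le_exp (c * (M + y)) (by positivity) p
  rw [div_le_iff₀ (by positivity), mul_pow] at h
  have h1 : (M + y) ^ p ≤ p.factorial / c ^ p * Real.exp (c * (M + y)) := by
    rw [div_mul_eq_mul_div, le_div_iff₀ (by positivity)]
    linarith
  calc (M + y) ^ p * Real.exp (-c * y)
      ≤ p.factorial / c ^ p * Real.exp (c * (M + y)) * Real.exp (-c * y) := by gcongr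
    _ = p.factorial / c ^ p * Real.exp (c * M) := by
      rw [mul_assoc, ← Real.exp_add]; ring_nf

/-- Half of the exponential rate absorbs the polynomial factor. Bounded real part is essential here,
since it gives `‖z‖ ≤ |M| + Im z`. -/
theorem StripDecay.mul_pow {h : ℂ → ℂ} (hd : StripDecay h) (p : ℕ) :
    StripDecay fun z => h z * z ^ p := by
  intro δ hδ M
  obtain ⟨C, c, hC, hc, H⟩ := hd δ hδ M
  obtain ⟨D, hD, H'⟩ := exists_add_pow_mul_exp_le |M| (abs_nonneg M) p (half_pos hc)
  refine ⟨C * D, c / 2, by positivity, half_pos hc, fun z hz hM => ?_⟩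
  have hz0 : 0 ≤ z.im := hδ.le.trans hz
  have h1 : ‖z‖ ≤ |M| + z.im := by
    refine (Complex.norm_le_abs_re_add_abs_im z).trans ?_
    rw [abs_of_nonneg hz0]
    linarith [le_abs_self M]
  calc ‖h z * z ^ p‖ = ‖h z‖ * ‖z‖ ^ p := by rw [norm_mul, norm_pow]
    _ ≤ C * Real.exp (-c * z.im) * (|M| + z.im) ^ p := by
      gcongr
      exact H z hz hM
    _ = C * ((|M| + z.im) ^ p * Real.exp (-(c / 2) * z.im)) * Real.exp (-(c / 2) * z.im) := by
      rw [show -c * z.im = -(c / 2) * z.im + -(c / 2) * z.im by ring, Real.exp_add]; ring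
    _ ≤ C * D * Real.exp (-(c / 2) * z.im) := by
      gcongr
      exact H' _ hz0

end

/-! ### Transformation laws under `T` and `S` -/

section

theorem tsum_mul_sub_shift {φ : ℤ → ℤ → ℂ} (hrow : ∀ m, Summable (φ m))
    (hrows : Summable fun m => ∑' n, φ m n) (ω : ℂ) (p q : ℤ) :
    ∑' m, ∑' n, (ω * φ m n - φ (m + p) (n + q)) = (ω - 1) * ∑' m, ∑' n, φ m n := by
  have erow : ∀ m, ∑' n, φ (m + p) (n + q) = ∑' n, φ (m + p) n := fun m =>
    (Equiv.addRight q).tsum_eq (φ (m + p))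
  have hrows' : Summable fun m => ∑' n, φ (m + p) n := (Equiv.addRight p).summable_iff.2 hrows
  have this : ∀ m, ∑' n, (ω * φ m n - φ (m + p) (n + q)) =
      ω * ∑' n, φ m n - ∑' n, φ (m + p) n := fun m => by
    have h : Summable fun n => φ (m + p) (n + q) := (Equiv.addRight q).summable_iff.2 (hrow (m + p))
    rw [((hrow m).mul_left ω).tsum_sub h, tsum_mul_left, erow]
  rw [tsum_congr this, (hrows.mul_left ω).tsum_sub hrows', tsum_mul_left, sub_mul, one_mul]
  exact congrArg _ ((Equiv.addRight p).tsum_eq fun m => ∑' n, φ m n)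

/-- Both iterated sums are shift invariant, so passing from `φ` to `ω φ` minus its shift multiplies
each of them by `ω - 1`. If that difference is absolutely summable its two iterated sums agree, and
`ω - 1` can be cancelled. -/
theorem tsum_comm_of_summable_shift_sub {φ : ℤ → ℤ → ℂ} (hrow : ∀ m, Summable (φ m))
    (hcol : ∀ n, Summable fun m => φ m n) (hrows : Summable fun m => ∑' n, φ m n)
    (hcols : Summable fun n => ∑' m, φ m n) {ω : ℂ} (hω : ω ≠ 1) (p q : ℤ)
    (hD : Summable (Function.uncurry fun m n => ω * φ m n - φ (m + p) (n + q))) :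
    ∑' n, ∑' m, φ m n = ∑' m, ∑' n, φ m n := by
  have h := Summable.tsum_comm' (f := fun m n => ω * φ m n - φ (m + p) (n + q)) hD
    (fun m => ((hrow m).mul_left ω).sub ((Equiv.addRight q).summable_iff.2 (hrow (m + p))))
    (fun n => ((hcol n).mul_left ω).sub ((Equiv.addRight p).summable_iff.2 (hcol (n + q))))
  rw [tsum_mul_sub_shift hrow hrows ω p q,
    tsum_mul_sub_shift (φ := fun n m => φ m n) hcol hcols ω q p] at h
  exact mul_left_cancel₀ (sub_ne_zero.2 hω) h

theorem inv_sq_sub_inv_sq {K : Type*} [Field K] {x y : K} (hx : x ≠ 0) (hy : y ≠ 0) :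
    x⁻¹ ^ 2 - y⁻¹ ^ 2 = (y - x) * (x⁻¹ * y⁻¹ ^ 2 + x⁻¹ ^ 2 * y⁻¹) := by
  field_simp
  ring

theorem summable_int_prod_of_isBigO {f : ℤ → ℤ → ℂ} {a : ℝ} (ha : 2 < a)
    (hf : (fun u : Fin 2 → ℤ => f (u 0) (u 1)) =O[Filter.cofinite] fun u => (‖u‖ ^ a)⁻¹) :
    Summable (Function.uncurry f) :=
  (finTwoArrowEquiv ℤ).summable_iff.1 (EisensteinSeries.summable_of_isBigO_rpow_norm ha hf)

theorem int_mul_add_int_ne_zero (τ : ℍ) {u : Fin 2 → ℤ} (hu : u ≠ 0) :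
    (u 0 : ℂ) * τ + u 1 ≠ 0 := by
  have := UpperHalfPlane.linear_ne_zero (cd := fun i => (u i : ℝ)) τ (fun h => hu (by
    ext i; simpa using congrFun h i))
  simpa using this

theorem rowAct_S_inv {N : ℕ} (v : Fin 2 → ZMod N) : rowAct v ModularGroup.S⁻¹ = ![-v 1, v 0] := by
  ext i
  rw [rowAct, Matrix.SpecialLinearGroup.coe_inv, ModularGroup.coe_S, Matrix.adjugate_fin_two]
  fin_cases i <;> simp [Matrix.vecMul, dotProduct, Fin.sum_univ_two]

theorem rowAct_T_inv {N : ℕ} (v : Fin 2 → ZMod N) : rowAct v ModularGroup.T⁻¹ = ![v 0, v 1 - v 0] := by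
  ext i
  rw [rowAct, Matrix.SpecialLinearGroup.coe_inv, ModularGroup.coe_T, Matrix.adjugate_fin_two]
  fin_cases i <;> simp [Matrix.vecMul, dotProduct, Fin.sum_univ_two]
  ring

variable {N : ℕ} [NeZero N]

/-- The `(m, n)`-th term of `H_k^v`. -/
def eisTerm (k : ℕ) (v : Fin 2 → ZMod N) (z : ℂ) (m n : ℤ) : ℂ :=
  ZMod.stdAddChar (pairing m n v) / ((m : ℂ) * z + n) ^ k

theorem eisSeries_eq_tsum_eisTerm (k : ℕ) (v : Fin 2 → ZMod N) (z : ℂ) :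
    eisSeries k v z = ∑' m : ℤ, ∑' n : ℤ, eisTerm k v z m n := rfl

theorem summable_eisTerm {k : ℕ} (hk : 3 ≤ k) (v : Fin 2 → ZMod N) (τ : ℍ) :
    Summable (Function.uncurry (eisTerm k v (τ : ℂ))) := by
  refine summable_int_prod_of_isBigO (a := k) (by exact_mod_cast hk) ?_
  have h := (EisensteinSeries.isBigO_linear_add_const_vec τ 0 0).pow k
  refine Asymptotics.IsBigO.trans (Asymptotics.IsBigO.of_bound 1 (.of_forall fun u => ?_))
    (h.trans (Asymptotics.IsBigO.of_bound 1 (.of_forall fun u => ?_)))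
  · simp [eisTerm]
  · simp

/-- Shifting multiplies the numerator by exactly the character value at `(p, q)`, so only a
difference of inverse squares is left; it is `O(‖u‖⁻³)`, which is summable over a rank 2 lattice. -/
theorem summable_eisTerm_shift_sub (v : Fin 2 → ZMod N) (τ : ℍ) (p q : ℤ) :
    Summable (Function.uncurry fun m n => ZMod.stdAddChar (pairing p q v) * eisTerm 2 v (τ : ℂ) m n -
      eisTerm 2 v (τ : ℂ) (m + p) (n + q)) := by
  refine summable_int_prod_of_isBigO (a := 3) (by norm_num) ?_
  have h0 := EisensteinSeries.isBigO_linear_add_const_vec τ 0 0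
  have h1 := EisensteinSeries.isBigO_linear_add_const_vec τ p q
  simp only [Int.cast_zero, add_zero] at h0
  have h := ((h0.mul (h1.pow 2)).add (((h0.pow 2).mul h1).congr_right fun u =>
    mul_comm _ _)).const_mul_left ((p : ℂ) * τ + q)
  refine Asymptotics.IsBigO.trans (Asymptotics.IsBigO.of_bound 1 ?_)
    (h.trans (Asymptotics.IsBigO.of_bound 1 (.of_forall fun u => ?_)))
  -- The two lattice points at which one of the denominators vanishes are discarded.
  · filter_upwards [(Set.finite_singleton (0 : Fin 2 → ℤ)).compl_mem_cofinite,
      (Set.finite_singleton (-![p, q] : Fin 2 → ℤ)).compl_mem_cofinite] with u hu hu'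
    have hx := int_mul_add_int_ne_zero τ hu
    have hy : ((u 0 : ℂ) + p) * τ + u 1 + q ≠ 0 := by
      have := int_mul_add_int_ne_zero τ (u := u + ![p, q])
        (fun h => hu' (eq_neg_of_add_eq_zero_left h))
      simpa [add_assoc] using this
    have hpair : ZMod.stdAddChar (pairing (u 0 + p) (u 1 + q) v) =
        ZMod.stdAddChar (pairing p q v) * (ZMod.stdAddChar (pairing (u 0) (u 1) v) : ℂ) := by
      rw [← AddChar.map_add_eq_mul]
      congr 1
      simp only [pairing]
      push_cast
      ring
    have hD : ZMod.stdAddChar (pairing p q v) * eisTerm 2 v (τ : ℂ) (u 0) (u 1) -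
        eisTerm 2 v (τ : ℂ) (u 0 + p) (u 1 + q) =
        (ZMod.stdAddChar (pairing p q v) * (ZMod.stdAddChar (pairing (u 0) (u 1) v) : ℂ)) *
        (((p : ℂ) * τ + q) *
          (((u 0 : ℂ) * τ + u 1)⁻¹ * (((u 0 : ℂ) + p) * τ + u 1 + q)⁻¹ ^ 2 +
            ((u 0 : ℂ) * τ + u 1)⁻¹ ^ 2 * (((u 0 : ℂ) + p) * τ + u 1 + q)⁻¹)) := by
      have hw : (p : ℂ) * τ + q =
          (((u 0 : ℂ) + p) * τ + u 1 + q) - ((u 0 : ℂ) * τ + u 1) := by ring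
      rw [eisTerm, eisTerm, hpair, hw, ← inv_sq_sub_inv_sq hx hy]
      push_cast
      rw [← add_assoc (((u 0 : ℂ) + p) * τ), inv_pow, inv_pow]
      ring
    rw [hD, norm_mul, norm_mul, norm_stdAddChar, norm_stdAddChar, one_mul]
  · rw [show (3 : ℝ) = (3 : ℕ) by norm_num, Real.rpow_natCast, one_mul]
    refine le_of_eq (congrArg _ ?_)
    rw [← inv_pow]
    ring

/-- The reindexing `n ↦ n - m` stays inside each row, so the order of summation plays no role. -/
theorem eisSeries_rowAct_T (k : ℕ) (v : Fin 2 → ZMod N) (z : ℂ) :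
    eisSeries k (rowAct v ModularGroup.T⁻¹) (z + 1) = eisSeries k v z := by
  rw [eisSeries_eq_tsum_eisTerm, eisSeries_eq_tsum_eisTerm, rowAct_T_inv]
  refine tsum_congr fun m => ?_
  rw [← (Equiv.subRight m).tsum_eq]
  refine tsum_congr fun n => ?_
  have h : pairing m (n - m) ![v 0, v 1 - v 0] = pairing m n v := by
    simp only [pairing, Matrix.cons_val_zero, Matrix.cons_val_one]
    push_cast
    ring
  simp only [eisTerm, Equiv.subRight_apply, h]
  push_cast
  ring_nf

/-- Columns of the series for `v` at `z` become rows of the series for `vS⁻¹` at `-1/z`. The law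
under `S` is therefore an exchange of the two summations. -/
theorem eisTerm_rowAct_S (k : ℕ) (v : Fin 2 → ZMod N) {z : ℂ} (hz : z ≠ 0) (m n : ℤ) :
    eisTerm k v z m n =
      (z ^ k)⁻¹ * eisTerm k (rowAct v ModularGroup.S⁻¹) (-1 / z) (-n) m := by
  have h : pairing (-n) m ![-v 1, v 0] = pairing m n v := by
    simp only [pairing, Matrix.cons_val_zero, Matrix.cons_val_one]
    push_cast
    ring
  rw [rowAct_S_inv, eisTerm, eisTerm, h,
    show (m : ℂ) * z + n = z * (((-n : ℤ) : ℂ) * (-1 / z) + m) by push_cast; field_simp; ring,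
    mul_pow, div_mul_eq_div_div_swap, div_eq_inv_mul _ (z ^ k)]

theorem eisSeries_rowAct_S {k : ℕ} (hk : 2 ≤ k) (v : Fin 2 → ZMod N) (hv : k = 2 → v ≠ 0)
    (τ : ℍ) : eisSeries k (rowAct v ModularGroup.S⁻¹) (-1 / (τ : ℂ)) =
      (τ : ℂ) ^ k * eisSeries k v τ := by
  have hτ : (τ : ℂ) ≠ 0 := τ.ne_zero
  have him : 0 < (-1 / (τ : ℂ)).im := by
    have := (UpperHalfPlane.mk _ τ.im_inv_neg_coe_pos).im_pos
    rwa [show -1 / (τ : ℂ) = (-(τ : ℂ))⁻¹ by rw [inv_neg, neg_div, one_div]]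
  have hrow : ∀ m, Summable (eisTerm k v (τ : ℂ) m) := fun m =>
    summable_periodicSum hk (rowChar v m) (m * (τ : ℂ))
  have hrows : Summable fun m => ∑' n, eisTerm k v (τ : ℂ) m n := summable_rows hk v τ.im_pos
  have hcol : ∀ n, Summable fun m => eisTerm k v (τ : ℂ) m n := fun n => by
    simp_rw [eisTerm_rowAct_S k v hτ]
    exact (summable_periodicSum hk (rowChar (rowAct v ModularGroup.S⁻¹) (-n)) _).mul_left _
  have ecol : ∀ n, ∑' m, eisTerm k v (τ : ℂ) m n = ((τ : ℂ) ^ k)⁻¹ *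
      ∑' m, eisTerm k (rowAct v ModularGroup.S⁻¹) (-1 / (τ : ℂ)) (-n) m := fun n => by
    simp_rw [eisTerm_rowAct_S k v hτ]
    rw [tsum_mul_left]
  have hcols : Summable fun n => ∑' m, eisTerm k v (τ : ℂ) m n := by
    simp_rw [ecol]
    exact Summable.mul_left _
      ((Equiv.neg ℤ).summable_iff.2 (summable_rows hk (rowAct v ModularGroup.S⁻¹) him))
  have hcomm : ∑' n, ∑' m, eisTerm k v (τ : ℂ) m n = ∑' m, ∑' n, eisTerm k v (τ : ℂ) m n := by
    rcases hk.eq_or_lt with rfl | hk3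
    · have hne : ∀ p q, pairing p q v ≠ 0 → (ZMod.stdAddChar (pairing p q v) : ℂ) ≠ 1 :=
        fun p q h h1 => h (ZMod.injective_stdAddChar (h1.trans (AddChar.map_zero_eq_one _).symm))
      -- The vectors `(0, -1)` and `(1, 0)` pair with `v` to its two coordinates, so the pairing
      -- cannot vanish identically.
      have hex : ∃ p q, pairing p q v ≠ 0 := by
        by_contra! hall
        refine hv rfl (funext fun i => ?_)
        fin_cases i
        · simpa [pairing] using hall 0 (-1)
        · simpa [pairing] using hall 1 0
      obtain ⟨p, q, hpq⟩ := hex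
      exact tsum_comm_of_summable_shift_sub hrow hcol hrows hcols (hne p q hpq) p q
        (summable_eisTerm_shift_sub v τ p q)
    · exact (summable_eisTerm hk3 v τ).tsum_comm' hrow hcol
  rw [eisSeries_eq_tsum_eisTerm k v, ← hcomm]
  simp_rw [ecol]
  rw [tsum_mul_left, mul_inv_cancel_left₀ (pow_ne_zero _ hτ), eisSeries_eq_tsum_eisTerm]
  exact ((Equiv.neg ℤ).tsum_eq _).symm

end

/-! ### The normalised series, its constants at the cusps, and its regularised primitive -/

section

variable {N : ℕ} [NeZero N]

theorem eisConst_eq {k : ℕ} (hk : 2 ≤ k) (v : Fin 2 → ZMod N) :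
    eisConst k v = (-1) ^ k * (-(2 * (Real.pi : ℂ) * Complex.I) ^ k / (k.factorial : ℂ) *
      ((((Polynomial.bernoulli k).eval (((v 0).val : ℚ) / (N : ℚ)) : ℚ) : ℂ))) := by
  have hN : (0 : ℝ) < N := Nat.cast_pos.2 (NeZero.pos N)
  have hx : ((v 0).val : ℝ) / N ∈ Set.Icc (0 : ℝ) 1 :=
    ⟨by positivity, (div_le_one hN).2 (by exact_mod_cast (ZMod.val_lt (v 0)).le)⟩
  have hB : bernoulliFun k (((v 0).val : ℝ) / N) =
      (((Polynomial.bernoulli k).eval (((v 0).val : ℚ) / (N : ℚ)) : ℚ) : ℝ) := by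
    rw [bernoulliFun, show ((v 0).val : ℝ) / N = algebraMap ℚ ℝ (((v 0).val : ℚ) / (N : ℚ)) by
      simp only [eq_ratCast, Rat.cast_div, Rat.cast_natCast],
      Polynomial.eval_map_apply]
    rfl
  have h := (hasSum_one_div_pow_mul_fourier_mul_bernoulliFun hk hx).tsum_eq
  rw [hB, Complex.ofReal_ratCast] at h
  -- The character of row `0` is `exp(-2πi n a/N)`, while the Bernoulli Fourier series carries the
  -- opposite sign. Writing `0` as `-0` brings in the reflection `n ↦ -n`, which produces `(-1)^k`.
  have h0 : eisConst k v = periodicSum k (rowChar v 0) (-0) := by rw [eisConst, neg_zero]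
  rw [← h, h0, periodicSum_neg, periodicSum]
  congr 1
  refine tsum_congr fun n => ?_
  have hchar : rowChar v 0 (-(n : ZMod N)) =
      fourier n ((((v 0).val : ℝ) / N : ℝ) : UnitAddCircle) := by
    rw [fourier_coe_apply, rowChar,
      show ((0 : ℤ) : ZMod N) * v 1 - -(n : ZMod N) * v 0 = ((n * ((v 0).val : ℤ) : ℤ) : ZMod N) by
        simp, ZMod.stdAddChar_coe]
    congr 1
    push_cast
    ring
  rw [hchar, zero_add]
  ring

/-- The constant Fourier coefficient of `ξ_k^v`. -/
def xiConst (k : ℕ) (v : Fin 2 → ZMod N) : ℂ :=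
  ((k - 1).factorial : ℂ) / (2 * (Real.pi : ℂ) * Complex.I) ^ k * eisConst k v

/-- The series `ξ_k^v` as a function on `ℂ`. -/
def xiSeries (k : ℕ) (v : Fin 2 → ZMod N) (z : ℂ) : ℂ :=
  ((k - 1).factorial : ℂ) / (2 * (Real.pi : ℂ) * Complex.I) ^ k * eisSeries k v z

theorem xiConst_eq {k : ℕ} (hk : 2 ≤ k) (v : Fin 2 → ZMod N) :
    xiConst k v = -((-1) ^ k *
      ((((Polynomial.bernoulli k).eval (((v 0).val : ℚ) / (N : ℚ)) : ℚ) : ℂ) / (k : ℂ))) := by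
  have h1 : (2 * (Real.pi : ℂ) * Complex.I) ≠ 0 := Complex.two_pi_I_ne_zero
  have h2 : (k : ℂ) ≠ 0 := by exact_mod_cast (show k ≠ 0 by omega)
  have h3 : ((k - 1).factorial : ℂ) ≠ 0 := by exact_mod_cast Nat.factorial_ne_zero _
  have h4 : (k.factorial : ℂ) = k * ((k - 1).factorial : ℂ) := by
    rw [← Nat.cast_mul, Nat.mul_factorial_pred (by omega)]
  rw [xiConst, eisConst_eq hk, h4]
  field_simp

theorem xi_eq_xiSeries {k : ℕ} (hk : 2 ≤ k) (v : Fin 2 → ZMod N) (τ : ℍ) :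
    xi k v τ = xiSeries k v τ := by
  rw [xi, eisH_eq_eisSeries hk, xiSeries]

theorem xi_ofComplex {k : ℕ} (hk : 2 ≤ k) (v : Fin 2 → ZMod N) {z : ℂ} (hz : 0 < z.im) :
    xi k v (UpperHalfPlane.ofComplex z) = xiSeries k v z := by
  rw [xi_eq_xiSeries hk, UpperHalfPlane.ofComplex_apply_of_im_pos hz]

theorem differentiableOn_xiSeries {k : ℕ} (hk : 2 ≤ k) (v : Fin 2 → ZMod N) :
    DifferentiableOn ℂ (xiSeries k v) {z | 0 < z.im} :=
  (differentiableOn_eisSeries hk v).const_mul _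

theorem exists_norm_xiSeries_sub_le {k : ℕ} (hk : 2 ≤ k) (v : Fin 2 → ZMod N) {δ : ℝ}
    (hδ : 0 < δ) : ∃ C : ℝ, 0 ≤ C ∧ ∀ z : ℂ, δ ≤ z.im →
      ‖xiSeries k v z - xiConst k v‖ ≤ C * Real.exp (-(2 * Real.pi / N) * z.im) := by
  obtain ⟨C, hC, h⟩ := exists_norm_eisSeries_sub_le hk v hδ
  refine ⟨‖((k - 1).factorial : ℂ) / (2 * (Real.pi : ℂ) * Complex.I) ^ k‖ * C, by positivity,
    fun z hz => ?_⟩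
  rw [xiSeries, xiConst, ← mul_sub, norm_mul, mul_assoc ‖_‖, neg_mul]
  exact mul_le_mul_of_nonneg_left (h z hz) (norm_nonneg _)

theorem stripDecay_xiSeries_sub {k : ℕ} (hk : 2 ≤ k) (v : Fin 2 → ZMod N) :
    StripDecay fun z => xiSeries k v z - xiConst k v := by
  intro δ hδ M
  obtain ⟨C, hC, h⟩ := exists_norm_xiSeries_sub_le hk v hδ
  exact ⟨C, _, hC, two_pi_div_pos N, fun z hz _ => h z hz⟩

theorem constInfty_xi {k : ℕ} (hk : 2 ≤ k) (v : Fin 2 → ZMod N) :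
    constInfty (xi k v) = xiConst k v := by
  refine Filter.Tendsto.limUnder_eq ?_
  obtain ⟨C, hC, h⟩ := exists_norm_xiSeries_sub_le hk v one_pos
  rw [tendsto_iff_norm_sub_tendsto_zero]
  have h1 : Filter.Tendsto (fun t : ℝ => C * Real.exp (-(2 * Real.pi / N) * t)) Filter.atTop
      (nhds (C * 0)) :=
    (Real.tendsto_exp_atBot.comp
      (Filter.tendsto_id.const_mul_atTop_of_neg (neg_lt_zero.2 (two_pi_div_pos N)))).const_mul C
  rw [mul_zero] at h1
  refine squeeze_zero' (.of_forall fun _ => norm_nonneg _) ?_ (h1.comp Filter.tendsto_comap)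
  filter_upwards [UpperHalfPlane.atImInfty_basis.mem_of_mem (i := 1) trivial] with τ hτ
  rw [xi_eq_xiSeries hk]
  exact h τ hτ

theorem xiSeries_rowAct_T (k : ℕ) (v : Fin 2 → ZMod N) (z : ℂ) :
    xiSeries k (rowAct v ModularGroup.T⁻¹) (z + 1) = xiSeries k v z := by
  rw [xiSeries, xiSeries, eisSeries_rowAct_T]

theorem xiSeries_rowAct_S {k : ℕ} (hk : 2 ≤ k) (v : Fin 2 → ZMod N) (hv : k = 2 → v ≠ 0)
    {z : ℂ} (hz : 0 < z.im) : xiSeries k (rowAct v ModularGroup.S⁻¹) (-1 / z) =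
      z ^ k * xiSeries k v z := by
  have h := eisSeries_rowAct_S hk v hv ⟨z, hz⟩
  rw [xiSeries, xiSeries, mul_left_comm, ← h]

theorem xiConst_rowAct_T {k : ℕ} (hk : 2 ≤ k) (v : Fin 2 → ZMod N) :
    xiConst k (rowAct v ModularGroup.T⁻¹) = xiConst k v := by
  rw [xiConst_eq hk, xiConst_eq hk, rowAct_T_inv]
  rfl

theorem im_neg_one_div_pos {z : ℂ} (hz : 0 < z.im) : 0 < (-1 / z).im := by
  rw [neg_div, one_div, Complex.neg_im, Complex.inv_im, neg_div, neg_neg]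
  exact div_pos hz (Complex.normSq_pos.2 fun h => by simp [h] at hz)

theorem coe_S_smul (τ : ℍ) : ((ModularGroup.S • τ : ℍ) : ℂ) = -1 / (τ : ℂ) := by
  rw [UpperHalfPlane.modular_S_smul, UpperHalfPlane.coe_mk, inv_neg, neg_div, one_div]

theorem coe_T_smul (τ : ℍ) : ((ModularGroup.T • τ : ℍ) : ℂ) = (τ : ℂ) + 1 := by
  rw [UpperHalfPlane.modular_T_smul, UpperHalfPlane.coe_vadd, Complex.ofReal_one, add_comm]

theorem constZero_xi {k : ℕ} (hk : 2 ≤ k) (v : Fin 2 → ZMod N) (hv : k = 2 → v ≠ 0) :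
    constZero k (xi k v) = xiConst k (rowAct v ModularGroup.S⁻¹) := by
  rw [← constInfty_xi hk, constZero, constInfty]
  congr 1
  ext w
  rw [xi_eq_xiSeries hk, xi_eq_xiSeries hk, coe_S_smul,
    ← xiSeries_rowAct_S hk v hv (im_neg_one_div_pos w.im_pos)]
  congr 1
  have := w.ne_zero
  field_simp

/-- The regularised integral of `ξ_k^v(z) z^p dz` from `w` to `i∞`, as a function of `w ∈ ℂ`. -/
def xiTail (k : ℕ) (v : Fin 2 → ZMod N) (p : ℕ) (w : ℂ) : ℂ :=
  -(xiConst k v * w ^ (p + 1) / ((p : ℂ) + 1)) +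
    ∫ t in Set.Ioi (0 : ℝ), (xiSeries k v (w + t * Complex.I) - xiConst k v) *
      (w + t * Complex.I) ^ p * Complex.I

theorem regIntInfty_xi {k : ℕ} (hk : 2 ≤ k) (v : Fin 2 → ZMod N) (p : ℕ) (τ : ℍ) :
    regIntInfty (xi k v) p τ = xiTail k v p τ := by
  rw [regIntInfty, xiTail, constInfty_xi hk]
  congr 1
  refine MeasureTheory.setIntegral_congr_fun measurableSet_Ioi fun t ht => ?_
  have ht' : 0 < t := ht
  rw [xi_ofComplex hk]
  rw [im_add_ofReal_mul_I]
  have : 0 < (τ : ℂ).im := τ.im_pos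
  linarith

theorem differentiableOn_xiSeries_sub_mul_pow {k : ℕ} (hk : 2 ≤ k) (v : Fin 2 → ZMod N) (p : ℕ) :
    DifferentiableOn ℂ (fun z => (xiSeries k v z - xiConst k v) * z ^ p) {z | 0 < z.im} :=
  ((differentiableOn_xiSeries hk v).sub_const _).mul (by fun_prop)

theorem hasDerivAt_xiTail {k : ℕ} (hk : 2 ≤ k) (v : Fin 2 → ZMod N) (p : ℕ) {w : ℂ}
    (hw : 0 < w.im) : HasDerivAt (xiTail k v p) (-(xiSeries k v w * w ^ p)) w := by
  have h1 := hasDerivAt_integral_ray (differentiableOn_xiSeries_sub_mul_pow hk v p)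
    ((stripDecay_xiSeries_sub hk v).mul_pow p) hw
  have h2 : HasDerivAt (fun w : ℂ => -(xiConst k v * w ^ (p + 1) / ((p : ℂ) + 1)))
      (-(xiConst k v * w ^ p)) w := by
    have hp : (p : ℂ) + 1 ≠ 0 := Nat.cast_add_one_ne_zero p
    convert! (((hasDerivAt_pow (p + 1) w).const_mul (xiConst k v)).div_const ((p : ℂ) + 1)).neg
      using 2
    push_cast
    field_simp
  convert! h2.add h1 using 1
  ring

theorem integrableOn_xiTail {k : ℕ} (hk : 2 ≤ k) (v : Fin 2 → ZMod N) (p : ℕ) {w : ℂ}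
    (hw : 0 < w.im) : MeasureTheory.IntegrableOn (fun t : ℝ =>
      (xiSeries k v (w + t * Complex.I) - xiConst k v) * (w + t * Complex.I) ^ p * Complex.I)
      (Set.Ioi 0) :=
  (integrableOn_ray (differentiableOn_xiSeries_sub_mul_pow hk v p).continuousOn
    ((stripDecay_xiSeries_sub hk v).mul_pow p) hw).mul_const _

end

/-! ### Evaluation of the cocycle and independence of the base point -/

section

theorem sub_mul_pow_eq_sum {k : ℕ} (hk : 2 ≤ k) (x y z : ℂ) :
    (x - z * y) ^ (k - 2) =
      ∑ p ∈ Finset.range (k - 1), ((k - 2).choose p : ℂ) * z ^ p * x ^ (k - 2 - p) * (-y) ^ p := by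
  rw [show x - z * y = z * (-y) + x by ring, add_pow, show k - 2 + 1 = k - 1 by omega]
  refine Finset.sum_congr rfl fun p _ => ?_
  rw [mul_pow]
  ring

/-- The sum is the integral of `(x - zy)^(k-2)` from `0` to `w`, taken term by term. The factor `y`
clears the denominator of its closed form, so `y = 0` needs no separate treatment. -/
theorem mul_sum_choose_mul_pow_div {k : ℕ} (hk : 2 ≤ k) (x y w : ℂ) :
    y * ∑ p ∈ Finset.range (k - 1), ((k - 2).choose p : ℂ) * (w ^ (p + 1) / ((p : ℂ) + 1)) *
      x ^ (k - 2 - p) * (-y) ^ p = (x ^ (k - 1) - (x - w * y) ^ (k - 1)) / ((k : ℂ) - 1) := by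
  obtain ⟨n, rfl⟩ : ∃ n, k = n + 2 := ⟨k - 2, by omega⟩
  rw [show n + 2 - 1 = n + 1 by omega, show n + 2 - 2 = n by omega,
    show x - w * y = w * (-y) + x by ring, add_pow, Finset.sum_range_succ' _ (n + 1)]
  have hn : ((n + 2 : ℕ) : ℂ) - 1 = n + 1 := by push_cast; ring
  have hn0 : (n : ℂ) + 1 ≠ 0 := Nat.cast_add_one_ne_zero n
  rw [hn, eq_div_iff hn0]
  simp only [pow_zero, one_mul, Nat.sub_zero, Nat.choose_zero_right, Nat.cast_one, mul_one]
  rw [sub_add_cancel_right, Finset.mul_sum, Finset.sum_mul, ← Finset.sum_neg_distrib]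
  refine Finset.sum_congr rfl fun p _ => ?_
  have hp0 : (p : ℂ) + 1 ≠ 0 := Nat.cast_add_one_ne_zero p
  have hc : ((n : ℂ) + 1) * (n.choose p : ℂ) = ((n + 1).choose (p + 1) : ℂ) * (p + 1) := by
    exact_mod_cast Nat.add_one_mul_choose_eq n p
  rw [Nat.add_sub_add_right]
  have hc' : ((n + 1).choose (p + 1) : ℂ) = ((n : ℂ) + 1) * (n.choose p : ℂ) / (p + 1) := by
    rw [hc, mul_div_cancel_right₀ _ hp0]
  rw [hc']
  field_simp
  ring

theorem eval_polyAct (P : MvPolynomial (Fin 2) ℂ) (γ : SL(2, ℤ)) (e : Fin 2 → ℂ) :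
    MvPolynomial.eval e (polyAct P γ) =
      MvPolynomial.eval (fun i => ((γ i 0 : ℤ) : ℂ) * e 0 + ((γ i 1 : ℤ) : ℂ) * e 1) P := by
  rw [polyAct, ← MvPolynomial.coe_aeval_eq_eval, ← MvPolynomial.coe_aeval_eq_eval]
  simp only [RingHom.coe_coe]
  rw [← AlgHom.comp_apply, MvPolynomial.comp_aeval]
  congr 2
  ext i
  simp [polyX, polyY]

variable {N : ℕ} [NeZero N]

/-- The value at `(x, y)` of the regularised integral of `ξ_k^v(z) (X - z Y)^(k-2) dz` from `w`
to `i∞`. -/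
def xiForm (k : ℕ) (v : Fin 2 → ZMod N) (x y w : ℂ) : ℂ :=
  ∑ p ∈ Finset.range (k - 1),
    ((k - 2).choose p : ℂ) * xiTail k v p w * x ^ (k - 2 - p) * (-y) ^ p

theorem eval_formInt {k : ℕ} (hk : 2 ≤ k) (v : Fin 2 → ZMod N) (τ : ℍ) (e : Fin 2 → ℂ) :
    MvPolynomial.eval e (formInt k (xi k v) τ) =
      2 * (Real.pi : ℂ) * Complex.I * xiForm k v (e 0) (e 1) τ := by
  simp [formInt, xiForm, regIntInfty_xi hk, polyX, polyY]

theorem eval_cocycle_T {k : ℕ} (hk : 2 ≤ k) (v : Fin 2 → ZMod N) (τ : ℍ) (e : Fin 2 → ℂ) :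
    MvPolynomial.eval e (cocycle k v ModularGroup.T τ) = 2 * (Real.pi : ℂ) * Complex.I *
      (xiForm k (rowAct v ModularGroup.T⁻¹) (e 0 + e 1) (e 1) (τ + 1) -
        xiForm k v (e 0) (e 1) τ) := by
  rw [cocycle, map_sub, eval_polyAct, eval_formInt hk, eval_formInt hk, coe_T_smul, mul_sub]
  simp [ModularGroup.coe_T]

theorem eval_cocycle_S {k : ℕ} (hk : 2 ≤ k) (v : Fin 2 → ZMod N) (τ : ℍ) (e : Fin 2 → ℂ) :
    MvPolynomial.eval e (cocycle k v ModularGroup.S τ) = 2 * (Real.pi : ℂ) * Complex.I *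
      (xiForm k (rowAct v ModularGroup.S⁻¹) (-e 1) (e 0) (-1 / (τ : ℂ)) -
        xiForm k v (e 0) (e 1) τ) := by
  rw [cocycle, map_sub, eval_polyAct, eval_formInt hk, eval_formInt hk, coe_S_smul, mul_sub]
  simp [ModularGroup.coe_S]

theorem mul_xiForm {k : ℕ} (hk : 2 ≤ k) (v : Fin 2 → ZMod N) (x y : ℂ) {w : ℂ} (hw : 0 < w.im) :
    y * xiForm k v x y w =
      -xiConst k v * ((x ^ (k - 1) - (x - w * y) ^ (k - 1)) / ((k : ℂ) - 1)) +
      y * ∫ t in Set.Ioi (0 : ℝ), (xiSeries k v (w + t * Complex.I) - xiConst k v) *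
        (x - (w + t * Complex.I) * y) ^ (k - 2) * Complex.I := by
  have hint : ∫ t in Set.Ioi (0 : ℝ), (xiSeries k v (w + t * Complex.I) - xiConst k v) *
        (x - (w + t * Complex.I) * y) ^ (k - 2) * Complex.I =
      ∑ p ∈ Finset.range (k - 1), ((k - 2).choose p : ℂ) * (∫ t in Set.Ioi (0 : ℝ),
        (xiSeries k v (w + t * Complex.I) - xiConst k v) * (w + t * Complex.I) ^ p * Complex.I) *
        x ^ (k - 2 - p) * (-y) ^ p := by
    have h : ∀ t : ℝ, (xiSeries k v (w + t * Complex.I) - xiConst k v) *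
        (x - (w + t * Complex.I) * y) ^ (k - 2) * Complex.I = ∑ p ∈ Finset.range (k - 1),
        (xiSeries k v (w + t * Complex.I) - xiConst k v) * (w + t * Complex.I) ^ p * Complex.I *
          (((k - 2).choose p : ℂ) * x ^ (k - 2 - p) * (-y) ^ p) := fun t => by
      rw [sub_mul_pow_eq_sum hk, Finset.mul_sum, Finset.sum_mul]
      refine Finset.sum_congr rfl fun p _ => by ring
    simp_rw [h]
    rw [MeasureTheory.integral_finsetSum _ fun p _ => (integrableOn_xiTail hk v p hw).mul_const _]
    refine Finset.sum_congr rfl fun p _ => ?_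
    rw [MeasureTheory.integral_mul_const]
    ring
  rw [hint, ← mul_sum_choose_mul_pow_div hk, mul_left_comm, ← mul_add]
  congr 1
  rw [xiForm, Finset.mul_sum, ← Finset.sum_add_distrib]
  refine Finset.sum_congr rfl fun p _ => ?_
  rw [xiTail]
  ring

/-- Since `x + y - (z + 1)y = x - zy`, the two integrals coincide and the powers of `x - wy` cancel.
What survives comes from the lower limit `0` of the primitives of the constant term. -/
theorem mul_xiForm_T {k : ℕ} (hk : 2 ≤ k) (v : Fin 2 → ZMod N) (x y : ℂ) {w : ℂ}
    (hw : 0 < w.im) :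
    y * (xiForm k (rowAct v ModularGroup.T⁻¹) (x + y) y (w + 1) - xiForm k v x y w) =
      -xiConst k v / ((k : ℂ) - 1) * ((x + y) ^ (k - 1) - x ^ (k - 1)) := by
  have hw' : 0 < (w + 1).im := by simpa using hw
  have h : ∀ t : ℝ, w + 1 + t * Complex.I = (w + t * Complex.I) + 1 := fun t => by ring
  rw [mul_sub, mul_xiForm hk _ _ _ hw', mul_xiForm hk _ _ _ hw, xiConst_rowAct_T hk]
  simp_rw [h, xiSeries_rowAct_T, show ∀ z : ℂ, x + y - (z + 1) * y = x - z * y from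
    fun z => by ring]
  ring

theorem hasDerivAt_xiForm {k : ℕ} (hk : 2 ≤ k) (v : Fin 2 → ZMod N) (x y : ℂ) {w : ℂ}
    (hw : 0 < w.im) :
    HasDerivAt (xiForm k v x y) (-(xiSeries k v w * (x - w * y) ^ (k - 2))) w := by
  have h : -(xiSeries k v w * (x - w * y) ^ (k - 2)) = ∑ p ∈ Finset.range (k - 1),
      ((k - 2).choose p : ℂ) * -(xiSeries k v w * w ^ p) * x ^ (k - 2 - p) * (-y) ^ p := by
    rw [sub_mul_pow_eq_sum hk, Finset.mul_sum, ← Finset.sum_neg_distrib]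
    exact Finset.sum_congr rfl fun p _ => by ring
  rw [h]
  exact HasDerivAt.fun_sum fun p _ =>
    (((hasDerivAt_xiTail hk v p hw).const_mul _).mul_const _).mul_const _

/-- The derivative in `w` is zero: the automorphy factor `w^k` is cancelled by `w^(-(k-2))` from the
polynomial and `w⁻²` from the differential of `-1/w`. -/
theorem xiForm_S_sub_eq {k : ℕ} (hk : 2 ≤ k) (v : Fin 2 → ZMod N) (hv : k = 2 → v ≠ 0)
    (x y : ℂ) {w w' : ℂ} (hw : 0 < w.im) (hw' : 0 < w'.im) :
    xiForm k (rowAct v ModularGroup.S⁻¹) (-y) x (-1 / w) - xiForm k v x y w =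
      xiForm k (rowAct v ModularGroup.S⁻¹) (-y) x (-1 / w') - xiForm k v x y w' := by
  have hderiv : ∀ z : ℂ, 0 < z.im → HasDerivAt (fun z : ℂ =>
      xiForm k (rowAct v ModularGroup.S⁻¹) (-y) x (-1 / z) - xiForm k v x y z) 0 z := by
    intro z hz
    have hz0 : z ≠ 0 := fun h => by simp [h] at hz
    have h1 : HasDerivAt (fun z : ℂ => -1 / z) (1 / z ^ 2) z := by
      simpa [neg_div, one_div] using (hasDerivAt_inv hz0).fun_neg
    have h2 := ((hasDerivAt_xiForm hk (rowAct v ModularGroup.S⁻¹) (-y) x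
      (im_neg_one_div_pos hz)).comp z h1).sub (hasDerivAt_xiForm hk v x y hz)
    convert! h2 using 1
    rw [xiSeries_rowAct_S hk v hv hz, show -y - -1 / z * x = (x - z * y) / z by field_simp; ring,
      div_pow]
    obtain ⟨n, rfl⟩ : ∃ n, k = n + 2 := ⟨k - 2, by omega⟩
    rw [show n + 2 - 2 = n by omega]
    field_simp
    ring
  have hconv : Convex ℝ {z : ℂ | 0 < z.im} := convex_halfSpace_im_gt 0
  exact (isOpen_im_gt 0).is_const_of_deriv_eq_zero hconv.isPreconnected
    (fun z hz => (hderiv z hz).differentiableAt.differentiableWithinAt)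
    (fun z hz => (hderiv z hz).deriv) hw hw'

end

/-! ### The inversion at `i` and the completed `L`-values -/

section

theorem image_inv_one_add_Ioi : (fun s : ℝ => (1 + s)⁻¹) '' Set.Ioi 0 = Set.Ioo 0 1 := by
  ext t
  constructor
  · rintro ⟨s, hs, rfl⟩
    have hs' : 0 < s := hs
    exact ⟨by positivity, inv_lt_one_of_one_lt₀ (by linarith)⟩
  · rintro ⟨h0, h1⟩
    exact ⟨t⁻¹ - 1, sub_pos.2 ((one_lt_inv₀ h0).2 h1), by simp⟩

/-- The substitution `t = 1/(1 + s)` is `z ↦ -1/z` on the imaginary axis: it matches the point `ti`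
of the segment with `i + si` on the ray. -/
theorem integral_Ioc_zero_one_eq (g : ℝ → ℂ) :
    ∫ t in Set.Ioc (0 : ℝ) 1, g t =
      ∫ s in Set.Ioi (0 : ℝ), ((1 + s : ℝ) : ℂ)⁻¹ ^ 2 * g ((1 + s)⁻¹) := by
  rw [MeasureTheory.integral_Ioc_eq_integral_Ioo, ← image_inv_one_add_Ioi,
    MeasureTheory.integral_image_eq_integral_abs_deriv_smul (f' := fun s => -((1 + s) ^ 2)⁻¹)
      measurableSet_Ioi]
  · refine MeasureTheory.setIntegral_congr_fun measurableSet_Ioi fun s hs => ?_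
    have hs' : 0 < s := hs
    simp only [abs_neg, abs_of_pos (show 0 < ((1 + s) ^ 2)⁻¹ by positivity), Complex.real_smul]
    push_cast
    rw [inv_pow]
  · intro s hs
    have hs' : 0 < s := hs
    have h := ((hasDerivAt_id s).const_add 1).inv (by simp; linarith)
    refine HasDerivAt.hasDerivWithinAt ?_
    convert! h using 1
    simp [neg_div]
  · intro a _ b _ h
    simpa using h

variable {N : ℕ} [NeZero N]

/-- With `u = -1/z`, weight `k` and `dz = u⁻² du` turn `z^p dz` into `(-u)^q du` with `q = k - 2 -
p`, and the reversed orientation gives the outer sign. The polar part at `0` becomes the constant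
term at `i∞`, so the regularising terms match too. -/
theorem regIntZero_xi_I {k : ℕ} (v : Fin 2 → ZMod N) (hv : k = 2 → v ≠ 0) {p q : ℕ}
    (hpq : k = p + q + 2) :
    regIntZero k (xi k v) p UpperHalfPlane.I =
      -((-1) ^ q * xiTail k (rowAct v ModularGroup.S⁻¹) q Complex.I) := by
  have hk : 2 ≤ k := by omega
  have hI : ∀ n : ℕ, (Complex.I ^ n)⁻¹ = (-1) ^ n * Complex.I ^ n := fun n => by
    rw [← inv_pow, Complex.inv_I, neg_pow]
  have hq : (q : ℂ) + 1 ≠ 0 := Nat.cast_add_one_ne_zero q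
  rw [regIntZero, constZero_xi hk v hv, xiTail, UpperHalfPlane.coe_I, mul_add, neg_add]
  congr 1
  · rw [show (p : ℤ) + 1 - (k : ℤ) = -((q + 1 : ℕ) : ℤ) by rw [hpq]; push_cast; ring,
      show (p : ℂ) + 1 - (k : ℂ) = -((q : ℂ) + 1) by rw [hpq]; push_cast; ring, zpow_neg,
      zpow_natCast, hI]
    field_simp
    ring
  · rw [integral_Ioc_zero_one_eq, ← MeasureTheory.integral_const_mul,
      ← MeasureTheory.integral_neg]
    refine MeasureTheory.setIntegral_congr_fun measurableSet_Ioi fun s hs => ?_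
    have hs' : 0 < s := hs
    have h1 : (0 : ℝ) < 1 + s := by linarith
    have h1c : ((1 + s : ℝ) : ℂ) ≠ 0 := by exact_mod_cast h1.ne'
    have him : 0 < ((((1 + s)⁻¹ : ℝ) : ℂ) * Complex.I).im := by
      rw [Complex.im_ofReal_mul, Complex.I_im]; positivity
    have hw0 : (((1 + s)⁻¹ : ℝ) : ℂ) * Complex.I ≠ 0 := fun h => by
      rw [h, Complex.zero_im] at him
      exact lt_irrefl _ him
    have hz : Complex.I + s * Complex.I = -1 / ((((1 + s)⁻¹ : ℝ) : ℂ) * Complex.I) := by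
      rw [eq_div_iff hw0, Complex.ofReal_inv,
        show Complex.I + s * Complex.I = ((1 + s : ℝ) : ℂ) * Complex.I by push_cast; ring,
        mul_mul_mul_comm, mul_inv_cancel₀ h1c, Complex.I_mul_I, one_mul]
    have hw2 : ((1 + s : ℝ) : ℂ)⁻¹ ^ 2 = -((((1 + s)⁻¹ : ℝ) : ℂ) * Complex.I) ^ 2 := by
      rw [mul_pow, Complex.I_sq, Complex.ofReal_inv]; ring
    have hxi := xiSeries_rowAct_S hk v hv him
    rw [xi_ofComplex hk v him, hz, hxi, hw2]
    generalize (((1 + s)⁻¹ : ℝ) : ℂ) * Complex.I = w at hw0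
    generalize xiConst k (rowAct v ModularGroup.S⁻¹) = b
    have e : (-1 : ℂ) ^ q * (-1 / w) ^ q = (w ^ q)⁻¹ := by
      rw [← mul_pow, ← inv_pow, neg_div, neg_mul_neg, one_mul, one_div]
    rw [show ∀ A B : ℂ, (-1 : ℂ) ^ q * (A * B * Complex.I) = A * ((-1) ^ q * B) * Complex.I from
      fun A B => by ring, e, zpow_neg, zpow_natCast, hpq]
    field_simp
    ring

/-- `S` exchanges the two variables up to sign; reversing the sum restores the monomials of the
untwisted form and pairs `p` with `k - 2 - p`, as the inversion does. -/
theorem sum_choose_mul_reflect {k : ℕ} (hk : 2 ≤ k) (f : ℕ → ℂ) (x y : ℂ) :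
    ∑ p ∈ Finset.range (k - 1), ((k - 2).choose p : ℂ) * f p * (-y) ^ (k - 2 - p) * (-x) ^ p =
      ∑ p ∈ Finset.range (k - 1), ((k - 2).choose p : ℂ) * ((-1) ^ (k - 2 - p) * f (k - 2 - p)) *
        x ^ (k - 2 - p) * (-y) ^ p := by
  rw [← Finset.sum_range_reflect]
  refine Finset.sum_congr rfl fun p hp => ?_
  have hp' : p ≤ k - 2 := by have := Finset.mem_range.1 hp; omega
  rw [show k - 1 - 1 - p = k - 2 - p by omega, Nat.choose_symm hp', Nat.sub_sub_self hp',
    neg_pow x]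
  ring

theorem xiForm_S_I {k : ℕ} (hk : 2 ≤ k) (v : Fin 2 → ZMod N) (hv : k = 2 → v ≠ 0) (x y : ℂ) :
    xiForm k (rowAct v ModularGroup.S⁻¹) (-y) x Complex.I - xiForm k v x y Complex.I =
      -∑ p ∈ Finset.range (k - 1), ((k - 2).choose p : ℂ) * x ^ (k - 2 - p) * (-y) ^ p *
        completedL k (xi k v) (p + 1) := by
  rw [xiForm, sum_choose_mul_reflect hk, xiForm, ← Finset.sum_sub_distrib,
    ← Finset.sum_neg_distrib]
  refine Finset.sum_congr rfl fun p hp => ?_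
  have hp' : p ≤ k - 2 := by have := Finset.mem_range.1 hp; omega
  rw [completedL, Nat.add_sub_cancel, regIntInfty_xi hk,
    regIntZero_xi_I v hv (p := p) (q := k - 2 - p) (by omega), UpperHalfPlane.coe_I]
  ring

end

end EisensteinCocycle
end

/-- The formula for `T` is multiplied through by `Y` to clear its denominator. Nothing is lost,
because `Y` is not a zero divisor. -/
theorem theorem4p2 (N : ℕ) [NeZero N] (k : ℕ) (hk : 2 ≤ k) (v : Fin 2 → ZMod N)
    (hv : k = 2 → v ≠ 0) (τ : UpperHalfPlane) :
    EisensteinCocycle.polyY * EisensteinCocycle.cocycle k v ModularGroup.T τ =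
        MvPolynomial.C
            ((-1 : ℂ) ^ k * (2 * (Real.pi : ℂ) * Complex.I / ((k : ℂ) - 1)) *
              ((((Polynomial.bernoulli k).eval (((v 0).val : ℚ) / (N : ℚ)) : ℚ) : ℂ) / (k : ℂ))) *
          ((EisensteinCocycle.polyX + EisensteinCocycle.polyY) ^ (k - 1) -
            EisensteinCocycle.polyX ^ (k - 1)) ∧
      EisensteinCocycle.cocycle k v ModularGroup.S τ =
        MvPolynomial.C (-(2 * (Real.pi : ℂ) * Complex.I)) *
          ∑ l ∈ Finset.range (k - 1),
            MvPolynomial.C ((k - 2).choose l : ℂ) *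
              EisensteinCocycle.polyX ^ (k - 2 - l) * (-EisensteinCocycle.polyY) ^ l *
              MvPolynomial.C
                (EisensteinCocycle.completedL k (EisensteinCocycle.xi k v) (l + 1)) := by
  -- The point `i` is fixed by `S`, so with this base point both integrals in the cocycle start at
  -- `i`.
  have hI : -1 / Complex.I = Complex.I := by rw [div_eq_mul_inv, Complex.inv_I]; ring
  constructor
  -- Over the infinite field `ℂ` a polynomial identity may be checked on values.
  · refine MvPolynomial.funext fun e => ?_
    rw [map_mul, EisensteinCocycle.eval_cocycle_T hk, mul_left_comm]
    simp only [EisensteinCocycle.polyX, EisensteinCocycle.polyY, map_mul, map_sub, map_pow,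
      map_add, MvPolynomial.eval_X, MvPolynomial.eval_C]
    rw [EisensteinCocycle.mul_xiForm_T hk v _ _ τ.im_pos, EisensteinCocycle.xiConst_eq hk]
    ring
  · refine MvPolynomial.funext fun e => ?_
    rw [EisensteinCocycle.eval_cocycle_S hk,
      EisensteinCocycle.xiForm_S_sub_eq hk v hv _ _ τ.im_pos (w' := Complex.I) (by simp), hI,
      EisensteinCocycle.xiForm_S_I hk v hv]
    simp only [EisensteinCocycle.polyX, EisensteinCocycle.polyY, map_mul, map_sum, map_pow,
      map_neg, MvPolynomial.eval_X, MvPolynomial.eval_C]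
    ring
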